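/- Definitions. Let $y_1,y_2,\dots$ be real numbers with $y_1=y_2=0$; put $p_i=(i,y_i)$, $q_i=(i,-y_i)$ and $H_n=\{p_i,q_i : 1\le i\le n\}$. The sequence is exploding, and $\bigcup_n H_n$ is an exploding double chain, if for every $n$ each line through two distinct points of $H_n$ meets the vertical line $x=n+1$ (if at all) strictly between $-y_{n+1}$ and $y_{n+1}$. Graphs are finite and simple. A plane graph is a graph with a fixed plane embedding, described combinatorially: for connected graphs (all that is needed here) by a cyclic order (rotation) of the edges around each vertex that satisfies Euler's formula $|V|-|E|+|F|=2$, where $F$ is the set of facial walks, together with the choice of an outer face. A one-sided Hamiltonian cycle of a plane graph $G$ is an enumeration $v_1,\dots,v_n$ ($n\ge 2$) of all its vertices such that, with $v_{n+1}=v_1$, $v_iv_{i+1}$ is an edge for $i=1,\dots,n$, the special edge $v_nv_1$ is incident to the outer face, and for every $j=2,\dots,n$ the edges $v_{j-1}v_j$ and $v_jv_{j+1}$ are consecutive in the rotation of $v_j$ in the subgraph of $G$ induced by $v_1,\dots,v_{j+1}$. (For $n=2$ the cycle degenerates to a single edge.) A graph is POSH if it is a spanning subgraph of a plane graph with a one-sided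 Hamiltonian cycle. Theorem. Let $y$ be an exploding sequence. Let $G'$ be POSH and let $v_1,\dots,v_n$ be a one-sided Hamiltonian cycle of a plane supergraph $G$ of $G'$ on the same vertex set. Then $G'$ has a crossing-free straight-line drawing in which each $v_i$ is placed at $p_i$ or at $q_i$. Consequently, for every $n\ge 2$ the set $H_n$, which has exactly $2n-2$ points, is $n$-universal for the class of POSH graphs: every POSH graph on $n$ vertices has a crossing-free straight-line drawing with all vertices at points of $H_n$. -/

import Mathlib

universe u

/-! ### The exploding double chain -/

/-- The point `p_i = (i, y_i)` of the upper chain. -/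
def upperPt (y : ℕ → ℝ) (i : ℕ) : ℝ × ℝ := ((i : ℝ), y i)

/-- The point `q_i = (i, -y_i)` of the lower chain. -/
def lowerPt (y : ℕ → ℝ) (i : ℕ) : ℝ × ℝ := ((i : ℝ), -y i)

/-- `H_n = {p_i, q_i | 1 ≤ i ≤ n}`. -/
def doubleChain (y : ℕ → ℝ) (n : ℕ) : Set (ℝ × ℝ) :=
  {x | ∃ i : ℕ, 1 ≤ i ∧ i ≤ n ∧ (x = upperPt y i ∨ x = lowerPt y i)}

/-- The sequence `y_1, y_2, …` is exploding: `y_1 = y_2 = 0`, and for every `n` each line through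
two points of `H_n` meets the vertical line `x = n + 1` only strictly between `-y_{n+1}` and
`y_{n+1}`. (The value `y 0` plays no role.) -/
def IsExploding (y : ℕ → ℝ) : Prop :=
  y 1 = 0 ∧ y 2 = 0 ∧
    ∀ n : ℕ, ∀ a ∈ doubleChain y n, ∀ b ∈ doubleChain y n, a ≠ b →
      ∀ c ∈ line[ℝ, a, b], c.1 = (n : ℝ) + 1 → -y (n + 1) < c.2 ∧ c.2 < y (n + 1)

/-! ### Straight-line drawings -/

/-- Placing each vertex `a` at `f a` and drawing the edges as straight segments is a crossing-free
drawing of `G`: distinct vertices are placed at distinct points, no edge passes through a vertex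
which is not one of its ends, and two distinct edges meet at most in a common end. -/
structure IsCrossingFreeDrawing {V : Type u} (G : SimpleGraph V) (f : V → ℝ × ℝ) : Prop where
  injective : Function.Injective f
  vertex_notMem : ∀ a b w : V, G.Adj a b → w ≠ a → w ≠ b → f w ∉ segment ℝ (f a) (f b)
  edge_inter : ∀ a b c d : V, G.Adj a b → G.Adj c d → s(a, b) ≠ s(c, d) →
    segment ℝ (f a) (f b) ∩ segment ℝ (f c) (f d) ⊆ f '' (({a, b} : Set V) ∩ {c, d})

/-- `P` is an `n`-universal point set for the class `C` of finite graphs. -/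
def IsUniversalPointSet (n : ℕ) (P : Set (ℝ × ℝ))
    (C : ∀ (V : Type u) [Finite V], SimpleGraph V → Prop) : Prop :=
  ∀ (V : Type u) [Finite V] (G : SimpleGraph V), Nat.card V = n → C V G →
    ∃ f : V → ℝ × ℝ, IsCrossingFreeDrawing G f ∧ ∀ a : V, f a ∈ P

/-! ### Plane graphs

A plane graph is given by its combinatorial embedding: the cyclic order of the edges around every
vertex, subject to Euler's formula (genus zero), together with the choice of the outer face. -/

/-- A rotation system on `G`. The dart `d` stands for the end of the edge `d.edge` at the vertex
`d.fst`; the permutation `rot` sends it to the next edge end in the rotation of `d.fst`. So the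
cycles of `rot` are exactly the sets of darts with a common first vertex. -/
structure RotationSystem {V : Type u} (G : SimpleGraph V) where
  rot : Equiv.Perm G.Dart
  rot_fst : ∀ d : G.Dart, (rot d).fst = d.fst
  sameCycle : ∀ d e : G.Dart, d.fst = e.fst → rot.SameCycle d e

namespace RotationSystem

variable {V : Type u} {G : SimpleGraph V}

/-- The face permutation: walk along the dart `d`, then leave its second vertex by the edge that
follows in the rotation there. -/
def facePerm (R : RotationSystem G) : Equiv.Perm G.Dart :=
  (SimpleGraph.Dart.symm_involutive (G := G)).toPerm.trans R.rot

/-- The faces are the cycles of the face permutation (facial walks). -/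
def Face (R : RotationSystem G) : Type u :=
  Quotient (Equiv.Perm.SameCycle.setoid R.facePerm)

/-- The face whose facial walk contains the dart `d`. -/
def faceOf (R : RotationSystem G) (d : G.Dart) : R.Face :=
  Quotient.mk (Equiv.Perm.SameCycle.setoid R.facePerm) d

/-- The vertices `a`, `b` are neighbours of a vertex `c`, and in the rotation of `c` in the
subgraph of `G` induced by `S` the edge `cb` directly follows the edge `ca` (for `a, b, c ∈ S`):
turning from `ca` one meets no edge to a vertex of `S` before `cb`. -/
def IsNextWithin (R : RotationSystem G) (S : Set V) (c a b : V) : Prop :=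
  ∃ (ha : G.Adj c a) (hb : G.Adj c b) (k : ℕ), 1 ≤ k ∧
    (R.rot ^ k) (⟨(c, a), ha⟩ : G.Dart) = ⟨(c, b), hb⟩ ∧
    ∀ m : ℕ, 1 ≤ m → m < k → ((R.rot ^ m) (⟨(c, a), ha⟩ : G.Dart)).snd ∉ S

/-- The edges `ca`, `cb` are consecutive in the (cyclic) rotation of `c` in the subgraph of `G`
induced by `S`. -/
def ConsecutiveWithin (R : RotationSystem G) (S : Set V) (c a b : V) : Prop :=
  R.IsNextWithin S c a b ∨ R.IsNextWithin S c b a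

end RotationSystem

/-- A plane embedding of a finite connected graph `G` with at least one edge: a rotation system
of genus zero, i.e. `|V| - |E| + |F| = 2`, with a choice of the outer face. -/
structure PlaneEmbedding {V : Type u} [Finite V] (G : SimpleGraph V) extends
    RotationSystem G where
  connected : G.Connected
  genus_zero : Nat.card V + Nat.card toRotationSystem.Face = Nat.card G.edgeSet + 2
  outer : toRotationSystem.Face

/-! ### One-sided Hamiltonian cycles and POSH graphs -/

/-- The enumeration `v_1 = v 0, …, v_n = v (n-1)` of all vertices is a one-sided Hamiltonian cycle
of the plane graph with special edge `v_n v_1`. Indices are cyclic, `v_{n+1} = v_1`. -/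
structure IsOneSidedHamiltonianCycle {V : Type u} [Finite V] {G : SimpleGraph V}
    (M : PlaneEmbedding G) {n : ℕ} (v : Fin n ≃ V) : Prop where
  /-- Consecutive vertices are adjacent, also the last and the first. -/
  adj : ∀ i : Fin n, G.Adj (v i) (v (finRotate n i))
  /-- The special edge is incident to the outer face. -/
  special_outer : ∀ i : Fin n, (i : ℕ) + 1 = n →
    ∃ d : G.Dart, d.edge = s(v i, v (finRotate n i)) ∧ M.faceOf d = M.outer
  /-- For `j = 2, …, n` the edges `v_{j-1} v_j` and `v_j v_{j+1}` are consecutive in the rotation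
  of `v_j` in the subgraph induced by `v_1, …, v_{j+1}`. -/
  oneSided : ∀ j : Fin n, 1 ≤ (j : ℕ) →
    M.ConsecutiveWithin {x | ∃ i : Fin n, (i : ℕ) ≤ (j : ℕ) + 1 ∧ x = v i}
      (v j) (v ((finRotate n).symm j)) (v (finRotate n j))

/-- POSH graphs: spanning subgraphs of plane graphs with a one-sided Hamiltonian cycle. -/
def IsPOSH (V : Type u) [Finite V] (G' : SimpleGraph V) : Prop :=
  ∃ (G : SimpleGraph V) (M : PlaneEmbedding G) (n : ℕ) (v : Fin n ≃ V),
    G' ≤ G ∧ IsOneSidedHamiltonianCycle M v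

/-!
A one-sided Hamiltonian cycle describes a two-page book embedding in which all edges from a vertex
to earlier vertices lie on the same page, and the exploding double chain realizes any such book
embedding with straight edges.

*Topology.* In genus zero the boundaries of sets of faces are exactly the cycles modulo 2: one
inclusion is clear, and Euler's formula says that the dimensions agree
(`PlaneEmbedding.exists_faceColouring`). So every cycle has two sides, given by a 2-colouring of the
faces, and an edge off the cycle has the same side at both of its ends
(`PlaneEmbedding.exists_cornerColouring`). For the Hamiltonian cycle, the consecutive edges
`v_{j-1} v_j` and `v_j v_{j+1}` leave all earlier neighbours of `v_j` on one side
(`IsOneSidedHamiltonianCycle.exists_backward_colour`). Two chords `v_i v_j` and `v_k v_l` with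
`i < k < j < l` lie on different sides
(`IsOneSidedHamiltonianCycle.colour_ne_of_interleaving`): the cycle formed by the path from `v_i` to
`v_j` and the chord `v_i v_j` is not crossed by the chord `v_k v_l`, nor by the path from `v_l` down
to `v_{j+1}`, so `v_k v_l` and `v_j v_{j+1}` are on the same side of it. Close to the path from
`v_k` to `v_j` its sides are those of the Hamiltonian cycle, and comparing the two cycles in the
rotation of `v_j` gives the claim (`add_eq_of_changesAt`).

*Geometry.* Place `v_j` at `p_j` or `q_j` according to the side of its earlier neighbours. As the
sequence is exploding, `p_j` is above, and `q_j` below, each line through two of the earlier points,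
which says that the edges from `v_j` to earlier vertices pass above, respectively below, all vertices
in between. Hence only edges that interleave and lie on the same page could cross
(`isCrossingFreeDrawing_of_pages`).
-/

/-! ### Faces of a plane graph bound all its cycles -/

section Homology

open Matrix

variable {V : Type u} {G : SimpleGraph V}

instance SimpleGraph.Dart.instFinite [Finite V] : Finite G.Dart :=
  Finite.of_injective _ SimpleGraph.Dart.toProd_injective

open Classical in
/-- The incidence matrix over `𝔽₂` of edges against the classes of a labelling `p` of the darts:
the entry at `(e, t)` counts the darts on `e` with label `t`. With the label "first vertex" this is
the edge-vertex incidence matrix, with the label "facial walk" the edge-face incidence matrix. -/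
noncomputable def dartIncidence [Fintype G.Dart] {T : Type u} (p : G.Dart → T) :
    Matrix G.edgeSet T (ZMod 2) :=
  fun e t => ∑ d : G.Dart, if d.edge = e ∧ p d = t then 1 else 0

theorem dartIncidence_mulVec [Fintype G.Dart] {T : Type u} [Fintype T] (p : G.Dart → T)
    (f : T → ZMod 2) (d : G.Dart) :
    (dartIncidence p *ᵥ f) ⟨d.edge, d.edge_mem⟩ = f (p d) + f (p d.symm) := by
  classical
  have h : (dartIncidence p *ᵥ f) ⟨d.edge, d.edge_mem⟩ =
      ∑ d' : G.Dart, if d'.edge = d.edge then f (p d') else 0 := by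
    simp only [Matrix.mulVec, dotProduct, dartIncidence, Finset.sum_mul]
    rw [Finset.sum_comm]
    refine Finset.sum_congr rfl fun d' _ => ?_
    by_cases h : d'.edge = d.edge <;> simp [h]
  rw [h, ← Finset.sum_filter]
  have h2 : (Finset.univ.filter fun d' : G.Dart => d'.edge = d.edge) = {d, d.symm} := by
    ext d'
    simp [SimpleGraph.dart_edge_eq_iff]
  rw [h2, Finset.sum_pair d.symm_ne.symm]

theorem dartIncidence_transpose_mulVec [Fintype G.Dart] {T : Type u} [Fintype G.edgeSet]
    [DecidableEq T] (p : G.Dart → T) (x : G.edgeSet → ZMod 2) (t : T) :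
    ((dartIncidence p)ᵀ *ᵥ x) t = ∑ d : G.Dart with p d = t, x ⟨d.edge, d.edge_mem⟩ := by
  classical
  simp only [Matrix.mulVec, dotProduct, dartIncidence, Finset.sum_mul, Matrix.transpose_apply]
  rw [Finset.sum_comm, Finset.sum_filter]
  refine Finset.sum_congr rfl fun d _ => ?_
  rw [Finset.sum_eq_single ⟨d.edge, d.edge_mem⟩]
  · by_cases h : p d = t <;> simp [h]
  · intro e _ he
    rw [if_neg, zero_mul]
    rintro ⟨h, -⟩
    exact he (Subtype.ext h.symm)
  · simp

/-- If only constant functions of the label agree at the two darts of every edge, then the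
incidence matrix has corank at most one. -/
theorem card_le_rank_dartIncidence_add_one [Fintype G.Dart] [Fintype G.edgeSet] {T : Type u}
    [Fintype T] (p : G.Dart → T)
    (hconst : ∀ f : T → ZMod 2, (∀ d, f (p d) = f (p d.symm)) → ∀ s t, f s = f t) :
    Fintype.card T ≤ (dartIncidence p).rank + 1 := by
  classical
  have hrn := LinearMap.finrank_range_add_finrank_ker (dartIncidence p).mulVecLin
  rw [Module.finrank_fintype_fun_eq_card] at hrn
  have hker : Module.finrank (ZMod 2) (LinearMap.ker (dartIncidence p).mulVecLin) ≤ 1 := by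
    have hle : LinearMap.ker (dartIncidence p).mulVecLin ≤
        Submodule.span (ZMod 2) {fun _ : T => (1 : ZMod 2)} := by
      intro f hf
      have hf' : dartIncidence p *ᵥ f = 0 := hf
      have hc := hconst f fun d => by
        have := dartIncidence_mulVec p f d
        rw [hf'] at this
        exact CharTwo.add_eq_zero.1 this.symm
      rw [Submodule.mem_span_singleton]
      by_cases hT : Nonempty T
      · exact ⟨f hT.some, funext fun t => by simpa using hc _ _⟩
      · exact ⟨0, funext fun t => (hT ⟨t⟩).elim⟩
    refine (Submodule.finrank_mono hle).trans ?_
    exact (finrank_span_le_card _).trans (by simp)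
  have : (dartIncidence p).rank = Module.finrank (ZMod 2)
    (LinearMap.range (dartIncidence p).mulVecLin) := rfl
  omega

theorem RotationSystem.faceOf_rot (R : RotationSystem G) (d : G.Dart) :
    R.faceOf (R.rot d) = R.faceOf d.symm := by
  refine (Quotient.sound ?_).symm
  change R.facePerm.SameCycle d.symm (R.rot d)
  refine ⟨1, ?_⟩
  simp [RotationSystem.facePerm]

/-- A function of the darts that is invariant under the rotation is a function of the vertex. -/
theorem RotationSystem.eq_of_fst_eq (R : RotationSystem G) {β : Type*} (f : G.Dart → β) {w : V}
    (hf : ∀ d : G.Dart, d.fst = w → f (R.rot d) = f d) {d e : G.Dart} (hd : d.fst = w)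
    (he : e.fst = w) [Finite G.Dart] : f d = f e := by
  obtain ⟨k, -, rfl⟩ := (R.sameCycle d e (hd.trans he.symm)).exists_pow_eq'
  clear he
  have hk : ∀ k : ℕ, ((R.rot ^ k) d).fst = w ∧ f ((R.rot ^ k) d) = f d := by
    intro k
    induction k with
    | zero => exact ⟨hd, rfl⟩
    | succ k ih =>
      rw [pow_succ', Equiv.Perm.mul_apply]
      exact ⟨(R.rot_fst _).trans ih.1, (hf _ ih.1).trans ih.2⟩
  exact (hk k).2.symm

theorem SimpleGraph.Connected.eq_of_adj (hG : G.Connected) {β : Type*} {f : V → β}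
    (hf : ∀ a b, G.Adj a b → f a = f b) (s t : V) : f s = f t := by
  obtain ⟨p⟩ := hG.preconnected s t
  induction p with
  | nil => rfl
  | cons h _ ih => exact (hf _ _ h).trans ih

/-- Exactness: in genus zero, every `𝔽₂`-cycle is the boundary of a set of faces. Boundaries are
cycles, and by Euler's formula the two spaces have the same dimension. -/
theorem PlaneEmbedding.exists_faceColouring [Finite V] (M : PlaneEmbedding G)
    [Fintype G.Dart] [DecidableEq V] (x : G.edgeSet → ZMod 2)
    (hx : ∀ w : V, ∑ d : G.Dart with d.fst = w, x ⟨d.edge, d.edge_mem⟩ = 0) :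
    ∃ A : M.Face → ZMod 2, ∀ d : G.Dart,
      A (M.faceOf d) + A (M.faceOf d.symm) = x ⟨d.edge, d.edge_mem⟩ := by
  classical
  have := Fintype.ofFinite V
  have : Finite M.Face := Quotient.finite _
  have := Fintype.ofFinite M.Face
  have := Fintype.ofFinite G.edgeSet
  set NV : Matrix G.edgeSet V (ZMod 2) := dartIncidence fun d : G.Dart => d.fst with hNV
  set NF : Matrix G.edgeSet M.Face (ZMod 2) := dartIncidence M.faceOf with hNF
  have hV : Fintype.card V ≤ NV.rank + 1 := by
    refine card_le_rank_dartIncidence_add_one _ fun f hf => ?_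
    exact M.connected.eq_of_adj fun a b hab => hf ⟨(a, b), hab⟩
  have hF : Fintype.card M.Face ≤ NF.rank + 1 := by
    refine card_le_rank_dartIncidence_add_one _ fun f hf s t => ?_
    obtain ⟨d, rfl⟩ := Quotient.exists_rep s
    obtain ⟨e, rfl⟩ := Quotient.exists_rep t
    change f (M.faceOf d) = f (M.faceOf e)
    have hinv : ∀ d e : G.Dart, d.fst = e.fst → f (M.faceOf d) = f (M.faceOf e) := fun d e hde =>
      M.eq_of_fst_eq (fun d => f (M.faceOf d)) (w := e.fst)
        (fun d _ => by rw [M.faceOf_rot, ← hf]) hde rfl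
    -- colour every vertex by the common value of `f` on the faces at its corners
    have hcol := M.connected.eq_of_adj
      (f := fun w => {c | ∃ d : G.Dart, d.fst = w ∧ f (M.faceOf d) = c}) ?_ d.fst e.fst
    · obtain ⟨d', hd', hc⟩ := hcol.subset ⟨d, rfl, rfl⟩
      exact hc.symm.trans (hinv _ _ hd')
    · have key : ∀ a b, G.Adj a b → {c | ∃ d : G.Dart, d.fst = a ∧ f (M.faceOf d) = c} ⊆
          {c | ∃ d : G.Dart, d.fst = b ∧ f (M.faceOf d) = c} := by
        rintro a b hab c ⟨d, hd, rfl⟩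
        refine ⟨⟨(b, a), hab.symm⟩, rfl, ?_⟩
        rw [hinv d ⟨(a, b), hab⟩ hd]
        exact (hf ⟨(a, b), hab⟩).symm
      exact fun a b hab => (key a b hab).antisymm (key b a hab.symm)
  have hle : LinearMap.range NF.mulVecLin ≤ LinearMap.ker NVᵀ.mulVecLin := by
    rintro _ ⟨A, rfl⟩
    refine funext fun w => ?_
    change (NVᵀ *ᵥ (NF *ᵥ A)) w = 0
    rw [hNV, dartIncidence_transpose_mulVec]
    simp only [hNF, dartIncidence_mulVec, ← M.faceOf_rot, Finset.sum_add_distrib]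
    have hre : ∑ d : G.Dart with d.fst = w, A (M.faceOf (M.rot d)) =
        ∑ d : G.Dart with d.fst = w, A (M.faceOf d) :=
      Finset.sum_equiv M.rot (fun d => by simp [M.rot_fst]) fun _ _ => rfl
    rw [hre, CharTwo.add_self_eq_zero]
  have hrn := LinearMap.finrank_range_add_finrank_ker NVᵀ.mulVecLin
  rw [Module.finrank_fintype_fun_eq_card] at hrn
  have hrV : Module.finrank (ZMod 2) (LinearMap.range NVᵀ.mulVecLin) = NV.rank :=
    NV.rank_transpose
  have heul := M.genus_zero
  have hfr : Module.finrank (ZMod 2) (LinearMap.ker NVᵀ.mulVecLin) ≤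
      Module.finrank (ZMod 2) (LinearMap.range NF.mulVecLin) := by
    have : NF.rank = Module.finrank (ZMod 2) (LinearMap.range NF.mulVecLin) := rfl
    simp only [Nat.card_eq_fintype_card] at heul
    omega
  have hxmem : x ∈ LinearMap.range NF.mulVecLin := by
    rw [Submodule.eq_of_le_of_finrank_le hle hfr]
    refine funext fun w => ?_
    change (NVᵀ *ᵥ x) w = 0
    rw [hNV, dartIncidence_transpose_mulVec]
    exact hx w
  obtain ⟨A, hA⟩ := hxmem
  exact ⟨A, fun d => by rw [← hA]; exact (dartIncidence_mulVec _ A d).symm⟩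

open Classical in
/-- A combinatorial Jordan curve theorem. Let `X` be a set of edges forming disjoint cycles of a
plane graph. Then the corners (the corner before the dart `d` in the rotation is named by `d`)
can be coloured with two colours so that crossing an edge, which is what both `d ↦ d.symm` and
`d ↦ rot d` do, changes the colour exactly when the edge is in `X`. -/
theorem PlaneEmbedding.exists_cornerColouring [Finite V] (M : PlaneEmbedding G)
    (X : V → V → Prop) (hsymm : ∀ a b, X a b → X b a) (hadj : ∀ a b, X a b → G.Adj a b)
    (hdeg : ∀ a, (∀ b, ¬ X a b) ∨ ∃ p q, p ≠ q ∧ ∀ b, X a b ↔ b = p ∨ b = q) :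
    ∃ c : G.Dart → ZMod 2,
      (∀ d, c d.symm = c d + if X d.fst d.snd then 1 else 0) ∧
      ∀ d, c (M.rot d) = c d + if X d.fst d.snd then 1 else 0 := by
  have := Fintype.ofFinite V
  let x : G.edgeSet → ZMod 2 := fun e => if ∃ a b, e.1 = s(a, b) ∧ X a b then 1 else 0
  have hxd : ∀ d : G.Dart, x ⟨d.edge, d.edge_mem⟩ = if X d.fst d.snd then 1 else 0 := by
    intro d
    refine if_congr ?_ rfl rfl
    constructor
    · rintro ⟨a, b, hab, h⟩
      have hab' : s(d.fst, d.snd) = s(a, b) := hab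
      rcases Sym2.eq_iff.1 hab' with ⟨h1, h2⟩ | ⟨h1, h2⟩
      · rwa [h1, h2]
      · rw [h1, h2]; exact hsymm _ _ h
    · exact fun h => ⟨_, _, rfl, h⟩
  obtain ⟨A, hA⟩ := M.exists_faceColouring x fun w => by
    simp only [hxd]
    rcases hdeg w with h | ⟨p, q, hpq, h⟩
    · refine Finset.sum_eq_zero fun d hd => if_neg ?_
      rw [(Finset.mem_filter.1 hd).2]
      exact h _
    · rw [← Finset.sum_filter, Finset.filter_filter]
      have hp : G.Adj w p := hadj _ _ ((h p).2 (Or.inl rfl))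
      have hq : G.Adj w q := hadj _ _ ((h q).2 (Or.inr rfl))
      have hset : (Finset.univ.filter fun d : G.Dart => d.fst = w ∧ X d.fst d.snd) =
          {⟨(w, p), hp⟩, ⟨(w, q), hq⟩} := by
        ext ⟨⟨a, b⟩, hab⟩
        simp only [Finset.mem_filter, Finset.mem_univ, true_and, Finset.mem_insert,
          Finset.mem_singleton, SimpleGraph.Dart.mk.injEq, Prod.mk.injEq]
        constructor
        · rintro ⟨rfl, hX⟩
          rcases (h b).1 hX with rfl | rfl <;> simp
        · rintro (⟨rfl, rfl⟩ | ⟨rfl, rfl⟩)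
          · exact ⟨rfl, (h _).2 (Or.inl rfl)⟩
          · exact ⟨rfl, (h _).2 (Or.inr rfl)⟩
      rw [hset, Finset.sum_pair (by simpa using hpq)]
      exact CharTwo.add_self_eq_zero 1
  have hs : ∀ d : G.Dart, A (M.faceOf d.symm) =
      A (M.faceOf d) + if X d.fst d.snd then 1 else 0 := fun d => by
    rw [← hxd, ← hA, ← add_assoc, CharTwo.add_self_eq_zero, zero_add]
  exact ⟨fun d => A (M.faceOf d), hs, fun d => by
    beta_reduce
    rw [M.faceOf_rot]
    exact hs d⟩

end Homology

/-! ### Colour changes along a cycle of a permutation -/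

section Rotation

variable {α : Type*} {π : Equiv.Perm α} {D e w : α}

theorem pow_apply_eq_of_forall_succ_eq {f : α → ZMod 2} {m t : ℕ} (hmt : m ≤ t)
    (h : ∀ s, m ≤ s → s < t → f ((π ^ (s + 1)) D) = f ((π ^ s) D)) :
    f ((π ^ t) D) = f ((π ^ m) D) := by
  induction t, hmt using Nat.le_induction with
  | base => rfl
  | succ t hmt ih =>
    rw [h t hmt t.lt_succ_self, ih fun s h1 h2 => h s h1 (h2.trans t.lt_succ_self)]

/-- The elements `D, e, w` are met in this order when `π` is iterated from `D`, and no one of them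
is met twice before `w` is reached. -/
def MeetsInOrder (π : Equiv.Perm α) (D e w : α) : Prop :=
  ∃ k t : ℕ, 0 < k ∧ k < t ∧ (π ^ k) D = e ∧ (π ^ t) D = w ∧
    ∀ s, 0 < s → s < t → (π ^ s) D ≠ D ∧ (π ^ s) D ≠ w ∧ ((π ^ s) D = e → s = k)

theorem meetsInOrder_of_pow {k t : ℕ} (hk : 0 < k) (hkt : k < t) (hke : (π ^ k) D = e)
    (htw : (π ^ t) D = w) (hmin : ∀ s, 0 < s → s < t → (π ^ s) D ≠ w) :
    MeetsInOrder π D e w := by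
  have hsplit : ∀ a b : ℕ, (π ^ (a + b)) D = (π ^ a) ((π ^ b) D) := fun a b => by
    rw [pow_add, Equiv.Perm.mul_apply]
  have hD : ∀ s, 0 < s → s < t → (π ^ s) D ≠ D := by
    intro s hs hst h
    refine hmin (t - s) (by omega) (by omega) ?_
    have := hsplit (t - s) s
    rw [h, Nat.sub_add_cancel hst.le, htw] at this
    exact this.symm
  refine ⟨k, t, hk, hkt, hke, htw, fun s hs hst => ⟨hD s hs hst, hmin s hs hst, fun hse => ?_⟩⟩
  have aux : ∀ a b : ℕ, a < b → b < t → (π ^ a) D = (π ^ b) D → False := by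
    intro a b hab hb h
    refine hD (b - a) (by omega) (by omega) ((π ^ a).injective ?_)
    rw [← hsplit, Nat.add_sub_cancel' hab.le, h]
  rcases lt_trichotomy s k with h | h | h
  · exact (aux s k h hkt (hse.trans hke.symm)).elim
  · exact h
  · exact (aux k s h hst (hke.trans hse.symm)).elim

open Classical in
/-- `f` changes its value exactly after `D` and after `w` on the cycle of `D` under `π`. -/
def ChangesAt (π : Equiv.Perm α) (f : α → ZMod 2) (D w : α) : Prop :=
  ∀ d, π.SameCycle D d → f (π d) = f d + if d = D ∨ d = w then 1 else 0

theorem ChangesAt.pow_succ {f : α → ZMod 2} (hf : ChangesAt π f D w) (s : ℕ) :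
    ((π ^ s) D = D ∨ (π ^ s) D = w) ∧ f ((π ^ (s + 1)) D) = f ((π ^ s) D) + 1 ∨
    ¬ ((π ^ s) D = D ∨ (π ^ s) D = w) ∧ f ((π ^ (s + 1)) D) = f ((π ^ s) D) := by
  have h := hf ((π ^ s) D) ⟨s, by simp⟩
  rw [← Equiv.Perm.mul_apply, ← pow_succ'] at h
  by_cases hc : (π ^ s) D = D ∨ (π ^ s) D = w
  · rw [if_pos hc] at h
    exact Or.inl ⟨hc, h⟩
  · rw [if_neg hc, add_zero] at h
    exact Or.inr ⟨hc, h⟩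

theorem ChangesAt.apply_succ {f : α → ZMod 2} (hf : ChangesAt π f D w) :
    f (π D) = f D + 1 := by
  simpa using hf D (Equiv.Perm.SameCycle.refl _ _)

theorem MeetsInOrder.apply_first {f : α → ZMod 2} (h : MeetsInOrder π D e w)
    (hf : ChangesAt π f D w) : f e = f D + 1 := by
  obtain ⟨k, t, hk, hkt, rfl, rfl, hs⟩ := h
  rw [← hf.apply_succ, ← pow_one π]
  refine pow_apply_eq_of_forall_succ_eq (m := 1) hk fun s h1 h2 => ?_
  rcases hf.pow_succ s with ⟨h | h, -⟩ | ⟨-, h⟩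
  · exact ((hs s h1 (by omega)).1 h).elim
  · exact ((hs s h1 (by omega)).2.1 h).elim
  · exact h

theorem MeetsInOrder.apply_second {f : α → ZMod 2} (h : MeetsInOrder π D e w)
    (hf : ChangesAt π f D e) : f w = f D := by
  obtain ⟨k, t, hk, hkt, rfl, rfl, hs⟩ := h
  have h1 : f ((π ^ k) D) = f D + 1 := by
    rw [← hf.apply_succ, ← pow_one π, ← pow_mul, one_mul]
    refine pow_apply_eq_of_forall_succ_eq (m := 1) hk fun s h1 h2 => ?_
    rcases hf.pow_succ s with ⟨h | h, -⟩ | ⟨-, h⟩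
    · exact ((hs s h1 (by omega)).1 h).elim
    · exact (h2.ne ((hs s h1 (by omega)).2.2 h)).elim
    · exact h
  have h2 : f ((π ^ (k + 1)) D) = f ((π ^ k) D) + 1 := by
    rcases hf.pow_succ k with ⟨-, h⟩ | ⟨h, -⟩
    · exact h
    · exact (h (Or.inr rfl)).elim
  have h3 : f ((π ^ t) D) = f ((π ^ (k + 1)) D) := by
    refine pow_apply_eq_of_forall_succ_eq hkt fun s h1 h2 => ?_
    rcases hf.pow_succ s with ⟨h | h, -⟩ | ⟨-, h⟩
    · exact ((hs s (by omega) (by omega)).1 h).elim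
    · exact absurd ((hs s (by omega) (by omega)).2.2 h) (by omega)
    · exact h
  rw [h3, h2, h1, add_assoc, CharTwo.add_self_eq_zero, add_zero]

open Classical in
theorem exists_first_pow [Finite α] (h : π.SameCycle D w) :
    ∃ t, 0 < t ∧ (π ^ t) D = w ∧ ∀ s, 0 < s → s < t → (π ^ s) D ≠ w := by
  have hex : ∃ t, 0 < t ∧ (π ^ t) D = w := by
    obtain ⟨t, ht, -, h⟩ := h.exists_pow_eq''
    exact ⟨t, ht, h⟩
  exact ⟨Nat.find hex, (Nat.find_spec hex).1, (Nat.find_spec hex).2,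
    fun s hs hst h => Nat.find_min hex hst ⟨hs, h⟩⟩

/-- Let two closed curves share the edge `D` at a vertex, and leave it by the edges `w` and `e`,
respectively. Let `a` and `b` tell the sides of the first and of the second curve. Then `e` lies on
the same side of the first curve as the corner before `D` if and only if `w` does not lie on the
same side of the second curve as that corner. -/
theorem add_eq_of_changesAt [Finite α] {a b : α → ZMod 2} (hew : e ≠ w) (hDe : π.SameCycle D e)
    (hDw : π.SameCycle D w) (ha : ChangesAt π a D w) (hb : ChangesAt π b D e) :
    a e + b w = a D + b D + 1 := by
  obtain ⟨k, hk, hke, hkmin⟩ := exists_first_pow hDe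
  obtain ⟨t, ht, htw, htmin⟩ := exists_first_pow hDw
  rcases lt_trichotomy k t with h | h | h
  · have hm := meetsInOrder_of_pow hk h hke htw htmin
    rw [hm.apply_first ha, hm.apply_second hb]
    ring
  · exact (hew (by rw [← hke, h, htw])).elim
  · have hm := meetsInOrder_of_pow ht h htw hke hkmin
    rw [hm.apply_second ha, hm.apply_first hb]
    ring

end Rotation

/-! ### The two pages of a one-sided Hamiltonian cycle -/

section Pages

variable {V : Type u} {G : SimpleGraph V} {n : ℕ}

theorem coe_finRotate_eq (i : Fin n) :
    ((finRotate n i : Fin n) : ℕ) = if (i : ℕ) + 1 = n then 0 else (i : ℕ) + 1 := by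
  cases n with
  | zero => exact i.elim0
  | succ m =>
    split_ifs with h
    · have : i = Fin.last m := Fin.ext (by simpa using h)
      rw [this, finRotate_last]
      rfl
    · exact coe_finRotate_of_ne_last fun hi => h (by rw [hi]; rfl)

/-- The edges of the cycle that consists of the path `v_i, v_{i+1}, …, v_j` and the edge
`v_j v_i`, for an enumeration `v` of the vertices. -/
def ArcCycle (v : Fin n ≃ V) (i j : Fin n) (a b : V) : Prop :=
  ((i : ℕ) ≤ v.symm a ∧ (v.symm a : ℕ) + 1 = v.symm b ∧ (v.symm b : ℕ) ≤ j) ∨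
  ((i : ℕ) ≤ v.symm b ∧ (v.symm b : ℕ) + 1 = v.symm a ∧ (v.symm a : ℕ) ≤ j) ∨
  (v.symm a = i ∧ v.symm b = j) ∨ (v.symm a = j ∧ v.symm b = i)

theorem arcCycle_symm {v : Fin n ≃ V} {i j : Fin n} {a b : V} (h : ArcCycle v i j a b) :
    ArcCycle v i j b a := by
  unfold ArcCycle at *
  tauto

theorem arcCycle_deg (v : Fin n ≃ V) {i j : Fin n} (hij : (i : ℕ) + 2 ≤ j) (a : V) :
    (∀ b, ¬ ArcCycle v i j a b) ∨
      ∃ p q, p ≠ q ∧ ∀ b, ArcCycle v i j a b ↔ b = p ∨ b = q := by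
  obtain ⟨x, rfl⟩ := v.surjective a
  have key : ∀ p q : Fin n, p ≠ q → (∀ b : Fin n, ArcCycle v i j (v x) (v b) ↔ b = p ∨ b = q) →
      ∃ p q, p ≠ q ∧ ∀ b, ArcCycle v i j (v x) b ↔ b = p ∨ b = q := by
    intro p q hpq h
    refine ⟨v p, v q, v.injective.ne hpq, fun b => ?_⟩
    obtain ⟨b, rfl⟩ := v.surjective b
    rw [h, v.injective.eq_iff, v.injective.eq_iff]
  have hj := j.isLt
  by_cases h1 : (x : ℕ) < i ∨ (j : ℕ) < x
  · left
    intro b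
    simp only [ArcCycle, Equiv.symm_apply_apply, Fin.ext_iff]
    omega
  · right
    by_cases h2 : (x : ℕ) = i
    · refine key ⟨i + 1, by omega⟩ j (by simp only [ne_eq, Fin.ext_iff]; omega) fun b => ?_
      simp only [ArcCycle, Equiv.symm_apply_apply, Fin.ext_iff]
      omega
    by_cases h3 : (x : ℕ) = j
    · refine key ⟨j - 1, by omega⟩ i (by simp only [ne_eq, Fin.ext_iff]; omega) fun b => ?_
      simp only [ArcCycle, Equiv.symm_apply_apply, Fin.ext_iff]
      omega
    refine key ⟨x - 1, by omega⟩ ⟨x + 1, by omega⟩ (by simp only [ne_eq, Fin.ext_iff]; omega)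
      fun b => ?_
    simp only [ArcCycle, Equiv.symm_apply_apply, Fin.ext_iff]
    omega

variable [Finite V]

namespace IsOneSidedHamiltonianCycle

variable {M : PlaneEmbedding G} {v : Fin n ≃ V}

theorem adj_succ (h : IsOneSidedHamiltonianCycle M v) {i j : Fin n} (hij : (i : ℕ) + 1 = j) :
    G.Adj (v i) (v j) := by
  have := h.adj i
  rwa [show finRotate n i = j from Fin.ext (by rw [coe_finRotate_eq]; split_ifs <;> omega)] at this

theorem adj_last (h : IsOneSidedHamiltonianCycle M v) {i j : Fin n} (hi : (i : ℕ) + 1 = n)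
    (hj : (j : ℕ) = 0) : G.Adj (v i) (v j) := by
  have := h.adj i
  rwa [show finRotate n i = j from Fin.ext (by rw [coe_finRotate_eq, if_pos hi, hj])] at this

open Classical in
/-- The corner colouring with respect to the cycle closed by the edge `v_i v_j`. -/
theorem exists_cornerColouring_arcCycle (h : IsOneSidedHamiltonianCycle M v) {i j : Fin n}
    (hij : (i : ℕ) + 2 ≤ j) (hadj : G.Adj (v i) (v j)) :
    ∃ c : G.Dart → ZMod 2,
      (∀ d, c d.symm = c d + if ArcCycle v i j d.fst d.snd then 1 else 0) ∧
      ∀ d, c (M.rot d) = c d + if ArcCycle v i j d.fst d.snd then 1 else 0 := by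
  refine M.exists_cornerColouring (ArcCycle v i j) (fun _ _ => arcCycle_symm) ?_
    (arcCycle_deg v hij)
  intro a b hab
  obtain ⟨a, rfl⟩ := v.surjective a
  obtain ⟨b, rfl⟩ := v.surjective b
  simp only [ArcCycle, Equiv.symm_apply_apply] at hab
  rcases hab with hab | hab | ⟨rfl, rfl⟩ | ⟨rfl, rfl⟩
  · exact h.adj_succ hab.2.1
  · exact (h.adj_succ hab.2.1).symm
  · exact hadj
  · exact hadj.symm

end IsOneSidedHamiltonianCycle

theorem RotationSystem.sameCycle_fst_eq (R : RotationSystem G) {d e : G.Dart}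
    (h : R.rot.SameCycle d e) : e.fst = d.fst := by
  obtain ⟨k, -, rfl⟩ := h.exists_pow_eq'
  induction k with
  | zero => rfl
  | succ k ih =>
    rw [pow_succ', Equiv.Perm.mul_apply, R.rot_fst]
    exact ih ⟨k, by simp⟩

open Classical in
/-- A corner colouring changes its value at a vertex of `X` after the two edges of `X` there. -/
theorem RotationSystem.changesAt_rot (R : RotationSystem G) {X : V → V → Prop}
    {c : G.Dart → ZMod 2} (hc : ∀ d, c (R.rot d) = c d + if X d.fst d.snd then 1 else 0)
    {w p q : V} (hp : G.Adj w p) (hq : G.Adj w q) (hX : ∀ b, X w b ↔ b = p ∨ b = q) :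
    ChangesAt R.rot c ⟨(w, p), hp⟩ ⟨(w, q), hq⟩ := by
  rintro ⟨⟨a, b⟩, hab⟩ hd
  obtain rfl : a = w := R.sameCycle_fst_eq hd
  rw [hc]
  simp [hX]

/-- Neighbours in `S` of the vertex `w` all lie on the same side of the two edges `wp`, `wq` if
these are consecutive within `S`. -/
theorem RotationSystem.IsNextWithin.colour_eq {R : RotationSystem G} {S : Set V} {w p q b : V}
    (h : R.IsNextWithin S w p q) (hp : G.Adj w p) (hq : G.Adj w q) (hb : G.Adj w b)
    (hbS : b ∈ S) (hbq : b ≠ q) {c : G.Dart → ZMod 2}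
    (hc : ChangesAt R.rot c ⟨(w, p), hp⟩ ⟨(w, q), hq⟩) :
    c ⟨(w, b), hb⟩ = c ⟨(w, p), hp⟩ := by
  obtain ⟨_, _, k, hk, hkq, hkS⟩ := h
  obtain ⟨t, ht, htb, htmin⟩ := exists_first_pow
    (R.sameCycle ⟨(w, p), hp⟩ ⟨(w, b), hb⟩ rfl)
  rcases lt_trichotomy k t with hkt | hkt | hkt
  · exact (meetsInOrder_of_pow hk hkt hkq htb htmin).apply_second hc
  · rw [← hkt, hkq] at htb
    simp only [SimpleGraph.Dart.mk.injEq, Prod.mk.injEq, true_and] at htb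
    exact (hbq htb.symm).elim
  · refine (hkS t ht hkt ?_).elim
    rw [htb]
    exact hbS

namespace IsOneSidedHamiltonianCycle

variable {M : PlaneEmbedding G} {v : Fin n ≃ V}

/-- With respect to the Hamiltonian cycle, all chords from `v_j` to earlier vertices lie on the
same side. -/
theorem exists_backward_colour (h : IsOneSidedHamiltonianCycle M v) {o l : Fin n}
    (ho : (o : ℕ) = 0) (hl : (l : ℕ) + 1 = n) {a : G.Dart → ZMod 2}
    (ha : ∀ p q r : Fin n, ∀ (hq : G.Adj (v p) (v q)) (hr : G.Adj (v p) (v r)),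
      (∀ b, ArcCycle v o l (v p) b ↔ b = v q ∨ b = v r) →
      ChangesAt M.rot a ⟨(v p, v q), hq⟩ ⟨(v p, v r), hr⟩) (j : Fin n) :
    ∃ s, ∀ i : Fin n, ∀ hji : G.Adj (v j) (v i), (i : ℕ) + 2 ≤ j →
      ¬ ArcCycle v o l (v j) (v i) → a ⟨(v j, v i), hji⟩ = s := by
  by_cases hj : (j : ℕ) < 2
  · exact ⟨0, fun i _ hi => by omega⟩
  set p := (finRotate n).symm j with hp
  have hpj : finRotate n p = j := (finRotate n).apply_symm_apply j
  set q := finRotate n j with hq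
  have hpv : (p : ℕ) + 1 = j := by
    have := coe_finRotate_eq p
    rw [hpj] at this
    split_ifs at this <;> omega
  have hqv : (q : ℕ) = if (j : ℕ) + 1 = n then 0 else (j : ℕ) + 1 := coe_finRotate_eq j
  have hadjp : G.Adj (v j) (v p) := (h.adj_succ hpv).symm
  have hadjq : G.Adj (v j) (v q) := h.adj j
  have hX : ∀ b, ArcCycle v o l (v j) b ↔ b = v p ∨ b = v q := by
    intro b
    obtain ⟨b, rfl⟩ := v.surjective b
    simp only [ArcCycle, Equiv.symm_apply_apply, v.injective.eq_iff, Fin.ext_iff, hqv]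
    have := b.isLt
    have := j.isLt
    split_ifs <;> omega
  have hcase := h.oneSided j (by omega)
  rw [← hp, ← hq] at hcase
  have hS : ∀ i : Fin n, (i : ℕ) + 2 ≤ j →
      v i ∈ {x | ∃ i : Fin n, (i : ℕ) ≤ (j : ℕ) + 1 ∧ x = v i} :=
    fun i hi => ⟨i, by omega, rfl⟩
  rcases hcase with hcase | hcase
  · refine ⟨_, fun i hji hi hXi => hcase.colour_eq hadjp hadjq hji (hS i hi) ?_
      (ha j p q hadjp hadjq hX)⟩
    rintro h'
    exact hXi ((hX _).2 (Or.inr h'))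
  · refine ⟨_, fun i hji hi hXi => hcase.colour_eq hadjq hadjp hji (hS i hi) ?_
      (ha j q p hadjq hadjp fun b => (hX b).trans or_comm)⟩
    rintro h'
    exact hXi ((hX _).2 (Or.inl h'))

open Classical in
/-- Two interleaving chords `v_i v_j`, `v_k v_l` lie on different sides of the Hamiltonian cycle:
the cycle closed by `v_i v_j` separates `v_k v_l` from `v_j v_{j+1}` otherwise. -/
theorem colour_ne_of_interleaving (h : IsOneSidedHamiltonianCycle M v) {o t : Fin n}
    (ho : (o : ℕ) = 0) (ht : (t : ℕ) + 1 = n) {a : G.Dart → ZMod 2}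
    (ha_symm : ∀ d, a d.symm = a d + if ArcCycle v o t d.fst d.snd then 1 else 0)
    (ha_rot : ∀ d, a (M.rot d) = a d + if ArcCycle v o t d.fst d.snd then 1 else 0)
    {i k j l : Fin n} (hik : i < k) (hkj : k < j) (hjl : j < l)
    (hij : G.Adj (v j) (v i)) (hkl : G.Adj (v l) (v k)) :
    a ⟨(v j, v i), hij⟩ ≠ a ⟨(v l, v k), hkl⟩ := by
  rw [Fin.lt_def] at hik hkj hjl
  have hln := l.isLt
  obtain ⟨b, hb_symm, hb_rot⟩ := h.exists_cornerColouring_arcCycle (i := i) (j := j)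
    (by omega) hij.symm
  set f : G.Dart := ⟨(v l, v k), hkl⟩ with hf
  have haf : a f.symm = a f := by
    rw [ha_symm, if_neg, add_zero]
    simp only [hf, ArcCycle, Equiv.symm_apply_apply, Fin.ext_iff]
    omega
  have hbf : b f.symm = b f := by
    rw [hb_symm, if_neg, add_zero]
    simp only [hf, ArcCycle, Equiv.symm_apply_apply, Fin.ext_iff]
    omega
  -- on the common path of the two cycles, the two colourings differ by a constant
  have hinner : ∀ m : ℕ, (k : ℕ) ≤ m → m < j → ∀ d : G.Dart, (v.symm d.fst : ℕ) = m →
      a d + b d = a f + b f := by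
    intro m hkm
    have hconst : ∀ m : ℕ, (k : ℕ) ≤ m → m < j → ∀ d e : G.Dart, (v.symm d.fst : ℕ) = m →
        (v.symm e.fst : ℕ) = m → a d + b d = a e + b e := by
      intro m hkm hmj d e hd he
      refine M.eq_of_fst_eq (fun d => a d + b d) (w := e.fst) (fun d' hd' => ?_)
        (v.symm.injective (Fin.ext (hd.trans he.symm))) rfl
      rw [ha_rot, hb_rot]
      have hiff : ArcCycle v o t d'.fst d'.snd ↔ ArcCycle v i j d'.fst d'.snd := by
        rw [← hd'] at he
        have := (v.symm d'.snd).isLt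
        simp only [ArcCycle, Fin.ext_iff]
        omega
      simp only [hiff]
      rw [add_add_add_comm, CharTwo.add_self_eq_zero, add_zero]
    induction m, hkm using Nat.le_induction with
    | base =>
      intro hmj d hd
      rw [← haf, ← hbf]
      exact hconst k le_rfl hmj d f.symm hd (by simp [hf])
    | succ m hkm ih =>
      intro hmj d hd
      let g : G.Dart := ⟨(v ⟨m, by omega⟩, v ⟨m + 1, by omega⟩), h.adj_succ rfl⟩
      have hg := ih (by omega) g (by simp [g])
      rw [hconst (m + 1) (by omega) hmj d g.symm hd (by simp [g]), ha_symm, hb_symm, if_pos, if_pos,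
        add_add_add_comm, CharTwo.add_self_eq_zero, add_zero, hg]
      all_goals
        simp only [g, ArcCycle, Equiv.symm_apply_apply, Fin.ext_iff, true_and]
        omega
  -- off the second cycle, its colouring does not change between `v_l` and `v_{j+1}`
  have houter : ∀ r m : ℕ, m + r = l → (j : ℕ) < m → ∀ d : G.Dart, (v.symm d.fst : ℕ) = m →
      b d = b f := by
    have hconst : ∀ m : ℕ, (j : ℕ) < m → ∀ d e : G.Dart, (v.symm d.fst : ℕ) = m →
        (v.symm e.fst : ℕ) = m → b d = b e := by
      intro m hjm d e hd he
      refine M.eq_of_fst_eq b (w := e.fst) (fun d' hd' => ?_)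
        (v.symm.injective (Fin.ext (hd.trans he.symm))) rfl
      rw [hb_rot, if_neg, add_zero]
      rw [← hd'] at he
      simp only [ArcCycle, Fin.ext_iff]
      omega
    intro r
    induction r with
    | zero =>
      intro m hm hjm d hd
      exact hconst m hjm d f hd (by simp [hf]; omega)
    | succ r ih =>
      intro m hm hjm d hd
      let g : G.Dart := ⟨(v ⟨m, by omega⟩, v ⟨m + 1, by omega⟩), h.adj_succ rfl⟩
      rw [hconst m hjm d g hd (by simp [g]), ← ih (m + 1) (by omega) (by omega) g.symm (by simp [g]),
        hb_symm, if_neg, add_zero]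
      simp only [g, ArcCycle, Equiv.symm_apply_apply, Fin.ext_iff]
      omega
  let p : Fin n := ⟨j - 1, by omega⟩
  let q : Fin n := ⟨j + 1, by omega⟩
  have hp : G.Adj (v j) (v p) := (h.adj_succ (by simp only [p]; omega)).symm
  have hq : G.Adj (v j) (v q) := h.adj_succ rfl
  have hD : a ⟨(v j, v p), hp⟩ + b ⟨(v j, v p), hp⟩ = a f + b f := by
    let g : G.Dart := ⟨(v p, v j), hp.symm⟩
    rw [← hinner (j - 1) (by omega) (by omega) g (by simp [g, p])]
    change a g.symm + b g.symm = _
    rw [ha_symm, hb_symm, if_pos, if_pos, add_add_add_comm, CharTwo.add_self_eq_zero, add_zero]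
    all_goals
      simp only [g, p, ArcCycle, Equiv.symm_apply_apply, Fin.ext_iff]
      omega
  have hu : b ⟨(v j, v q), hq⟩ = b f := by
    let g : G.Dart := ⟨(v q, v j), hq.symm⟩
    rw [← houter (l - (j + 1)) (j + 1) (by omega) (by omega) g (by simp [g, q])]
    change b g.symm = _
    rw [hb_symm, if_neg, add_zero]
    simp only [g, q, ArcCycle, Equiv.symm_apply_apply, Fin.ext_iff]
    omega
  have hlink := add_eq_of_changesAt (π := M.rot) (D := ⟨(v j, v p), hp⟩) (e := ⟨(v j, v i), hij⟩)
    (w := ⟨(v j, v q), hq⟩) (a := a) (b := b) ?_ (M.sameCycle _ _ rfl) (M.sameCycle _ _ rfl)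
    (M.changesAt_rot ha_rot _ _ fun c => ?_) (M.changesAt_rot hb_rot _ _ fun c => ?_)
  · rw [hD, hu, add_right_comm] at hlink
    intro heq
    rw [add_right_cancel hlink] at heq
    simp at heq
  · simp only [ne_eq, SimpleGraph.Dart.mk.injEq, Prod.mk.injEq, true_and, v.injective.eq_iff,
      Fin.ext_iff, q]
    omega
  all_goals
    obtain ⟨c, rfl⟩ := v.surjective c
    have := c.isLt
    simp only [ArcCycle, Equiv.symm_apply_apply, v.injective.eq_iff, Fin.ext_iff, true_and, p, q]
    omega

/-- The vertices can be labelled with two pages, such that no two edges interleave if their later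
ends have the same label. -/
theorem exists_pages (h : IsOneSidedHamiltonianCycle M v) :
    ∃ s : Fin n → ZMod 2, ∀ i k j l : Fin n, i < k → k < j → j < l →
      G.Adj (v i) (v j) → G.Adj (v k) (v l) → s j ≠ s l := by
  classical
  by_cases hn : n < 3
  · exact ⟨0, fun i k j l h1 h2 h3 => by have := l.isLt; rw [Fin.lt_def] at h1 h2 h3; omega⟩
  let o : Fin n := ⟨0, by omega⟩
  let t : Fin n := ⟨n - 1, by omega⟩
  have ho : (o : ℕ) = 0 := rfl
  have ht : (t : ℕ) + 1 = n := by simp only [t]; omega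
  obtain ⟨a, ha_symm, ha_rot⟩ := h.exists_cornerColouring_arcCycle (i := o) (j := t)
    (by omega) (h.adj_last ht ho).symm
  choose s hs using h.exists_backward_colour ho ht (a := a)
    fun p q r hq hr hX => M.changesAt_rot ha_rot hq hr hX
  refine ⟨s, fun i k j l hik hkj hjl hij hkl => ?_⟩
  have hne := h.colour_ne_of_interleaving ho ht ha_symm ha_rot hik hkj hjl hij.symm hkl.symm
  rw [Fin.lt_def] at hik hkj hjl
  have := l.isLt
  rwa [hs j i hij.symm (by omega), hs l k hkl.symm (by omega)] at hne
  all_goals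
    simp only [ArcCycle, Equiv.symm_apply_apply, Fin.ext_iff]
    omega

end IsOneSidedHamiltonianCycle

end Pages

/-! ### Straight-line drawings of two-page graphs -/

section Drawing

/-- Twice the signed area of the triangle `abc`, positive if `c` lies to the left of the line from
`a` to `b`. -/
def orient (a b c : ℝ × ℝ) : ℝ :=
  (b.1 - a.1) * (c.2 - a.2) - (b.2 - a.2) * (c.1 - a.1)

theorem orient_swap_right (a b c : ℝ × ℝ) : orient a c b = -orient a b c := by
  unfold orient; ring

theorem orient_swap_left (a b c : ℝ × ℝ) : orient b a c = -orient a b c := by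
  unfold orient; ring

theorem orient_combo (a b p q : ℝ × ℝ) {s t : ℝ} (h : s + t = 1) :
    orient a b (s • p + t • q) = s * orient a b p + t * orient a b q := by
  obtain rfl : s = 1 - t := by linarith
  simp only [orient, Prod.fst_add, Prod.snd_add, Prod.smul_fst, Prod.smul_snd, smul_eq_mul]
  ring

theorem orient_eq_zero_of_mem_segment {a b z : ℝ × ℝ} (hz : z ∈ segment ℝ a b) :
    orient a b z = 0 := by
  obtain ⟨s, t, -, -, hst, rfl⟩ := hz
  rw [orient_combo a b a b hst]
  unfold orient
  ring

theorem disjoint_segment_of_orient {a b p q : ℝ × ℝ} {r : ℝ} (hp : 0 < r * orient a b p)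
    (hq : 0 < r * orient a b q) : Disjoint (segment ℝ a b) (segment ℝ p q) := by
  refine Set.disjoint_left.2 fun z hz hz' => ?_
  have h0 := orient_eq_zero_of_mem_segment hz
  obtain ⟨s, t, hs, ht, hst, rfl⟩ := hz'
  rw [orient_combo a b p q hst] at h0
  have h1 : s * (r * orient a b p) + t * (r * orient a b q) = 0 := by linear_combination r * h0
  rcases hs.eq_or_lt with rfl | hs
  · obtain rfl : t = 1 := by linarith
    linarith
  · have := mul_pos hs hp
    have := mul_nonneg ht hq.le
    linarith

theorem eq_of_mem_segment_of_orient_ne {a b c z : ℝ × ℝ} (h : orient a b c ≠ 0)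
    (hz : z ∈ segment ℝ a b) (hz' : z ∈ segment ℝ a c) : z = a := by
  have h0 := orient_eq_zero_of_mem_segment hz
  obtain ⟨s, t, -, -, hst, rfl⟩ := hz'
  rw [orient_combo a b a c hst, show orient a b a = 0 by unfold orient; ring, mul_zero, zero_add,
    mul_eq_zero, or_iff_left h] at h0
  obtain rfl : s = 1 := by linarith
  rw [h0, one_smul, zero_smul, add_zero]

variable {V : Type u} [LinearOrder V] {P : V → ℝ × ℝ} {r : V → ℝ}

theorem orient_ne_zero_of_ne
    (ho : ∀ a b c, a < b → b < c → 0 < r c * orient (P a) (P b) (P c)) {a b c : V}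
    (hab : a ≠ b) (hac : a ≠ c) (hbc : b ≠ c) : orient (P a) (P b) (P c) ≠ 0 := by
  have key : ∀ a b c, a < b → b < c → orient (P a) (P b) (P c) ≠ 0 := fun a b c h1 h2 h =>
    absurd (ho a b c h1 h2) (by rw [h, mul_zero]; exact lt_irrefl 0)
  -- sort the three points, exchanging neighbours
  have key2 : ∀ a b c, a < b → b ≠ c → a ≠ c → orient (P a) (P b) (P c) ≠ 0 := by
    intro a b c hab hbc hac
    rcases hbc.lt_or_gt with h | h
    · exact key a b c hab h
    rw [← neg_ne_zero, ← orient_swap_right]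
    rcases hac.lt_or_gt with h' | h'
    · exact key a c b h' h
    rw [← neg_ne_zero, ← orient_swap_left]
    exact key c a b h' hab
  rcases hab.lt_or_gt with h | h
  · exact key2 a b c h hbc hac
  · rw [← neg_ne_zero, ← orient_swap_left]
    exact key2 b a c h hac hbc

variable {H : SimpleGraph V}

/-- Two edges without a common end are drawn disjointly. Here `j` is not the last of the four
ends, so that `l` lies beyond all others. -/
theorem disjoint_segment_of_pages (hx : StrictMono fun a => (P a).1)
    (hr : ∀ a, r a = 1 ∨ r a = -1)
    (ho : ∀ a b c, a < b → b < c → 0 < r c * orient (P a) (P b) (P c))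
    (hcross : ∀ i k j l, i < k → k < j → j < l → H.Adj i j → H.Adj k l → r j ≠ r l)
    {i j k l : V} (hij : i < j) (hkl : k < l) (hjl : j < l) (hki : k ≠ i) (hkj : k ≠ j)
    (hadj : H.Adj i j) (hadj' : H.Adj k l) :
    Disjoint (segment ℝ (P i) (P j)) (segment ℝ (P k) (P l)) := by
  rcases hki.lt_or_gt with hki | hik
  · -- the line through `k` and `l` passes above both `i` and `j` if `r l = 1`, below if `r l = -1`
    refine (disjoint_segment_of_orient (r := -r l) ?_ ?_).symm
    · rw [orient_swap_right, neg_mul_neg]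
      exact ho k i l hki (hij.trans hjl)
    · rw [orient_swap_right, neg_mul_neg]
      exact ho k j l (hki.trans hij) hjl
  rcases hkj.lt_or_gt with hkj | hjk
  · -- `k` and `l` are on the same side of the line through `i` and `j`
    refine disjoint_segment_of_orient (r := r l) ?_ (ho i j l hij hjl)
    have hne := hcross i k j l hik hkj hjl hadj hadj'
    have hneg : r l = -r j := by
      rcases hr j with h | h <;> rcases hr l with h' | h' <;> rw [h, h'] at hne ⊢ <;> simp at hne ⊢
    rw [hneg, orient_swap_right, neg_mul_neg]
    exact ho i k j hik hkj
  · -- a vertical line separates the edges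
    refine Set.disjoint_left.2 fun z hz hz' => ?_
    have h1 : z.1 ≤ (P j).1 := by
      obtain ⟨s, t, hs, ht, hst, rfl⟩ := hz
      have := mul_le_mul_of_nonneg_left (hx hij).le hs
      simp only [Prod.fst_add, Prod.smul_fst, smul_eq_mul] at this ⊢
      linear_combination this + (P j).1 * hst
    have h2 : (P k).1 ≤ z.1 := by
      obtain ⟨s, t, hs, ht, hst, rfl⟩ := hz'
      have := mul_le_mul_of_nonneg_left (hx hkl).le ht
      simp only [Prod.fst_add, Prod.smul_fst, smul_eq_mul] at this ⊢
      linear_combination this - (P k).1 * hst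
    exact absurd (hx hjk) (not_lt.2 (h2.trans h1))

/-- Suppose that the points are in general position, ordered from left to right, and that every
point `c` is above (`r c = 1`) or below (`r c = -1`) all lines through two earlier points. Then
the edge from `c` to an earlier vertex passes above, respectively below, all vertices in between,
so that only edges which interleave and whose later ends are on the same side could cross. -/
theorem isCrossingFreeDrawing_of_pages (hx : StrictMono fun a => (P a).1)
    (hr : ∀ a, r a = 1 ∨ r a = -1)
    (ho : ∀ a b c, a < b → b < c → 0 < r c * orient (P a) (P b) (P c))
    (hcross : ∀ i k j l, i < k → k < j → j < l → H.Adj i j → H.Adj k l → r j ≠ r l) :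
    IsCrossingFreeDrawing H P where
  injective a b hab := hx.injective (congrArg Prod.fst hab)
  vertex_notMem a b w hab hwa hwb hw :=
    orient_ne_zero_of_ne ho hab.ne hwa.symm hwb.symm (orient_eq_zero_of_mem_segment hw)
  edge_inter := by
    -- edges with a common end `a`
    have hshare : ∀ a b c, H.Adj a b → H.Adj a c → b ≠ c → ∀ z ∈ segment ℝ (P a) (P b),
        z ∈ segment ℝ (P a) (P c) → z = P a := fun a b c hab hac hbc z hz hz' =>
      eq_of_mem_segment_of_orient_ne (orient_ne_zero_of_ne ho hab.ne hac.ne hbc) hz hz'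
    have hsorted : ∀ a b c d, a < b → c < d → H.Adj a b → H.Adj c d → s(a, b) ≠ s(c, d) →
        segment ℝ (P a) (P b) ∩ segment ℝ (P c) (P d) ⊆ P '' (({a, b} : Set V) ∩ {c, d}) := by
      rintro a b c d hab hcd hadj hadj' hne z ⟨hz, hz'⟩
      by_cases hac : a = c
      · subst hac
        exact ⟨a, by simp, (hshare a b d hadj hadj' (by rintro rfl; exact hne rfl) z hz hz').symm⟩
      by_cases hbd : b = d
      · subst hbd
        rw [segment_symm] at hz hz'
        exact ⟨b, by simp, (hshare b a c hadj.symm hadj'.symm hac z hz hz').symm⟩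
      by_cases had : a = d
      · subst had
        rw [segment_symm] at hz'
        exact ⟨a, by simp, (hshare a b c hadj hadj'.symm (hcd.trans hab).ne' z hz hz').symm⟩
      by_cases hbc : b = c
      · subst hbc
        rw [segment_symm] at hz
        exact ⟨b, by simp, (hshare b a d hadj.symm hadj' (hab.trans hcd).ne z hz hz').symm⟩
      exfalso
      rcases lt_or_gt_of_ne hbd with h | h
      · exact Set.disjoint_left.1 (disjoint_segment_of_pages hx hr ho hcross hab hcd h
          (Ne.symm hac) (Ne.symm hbc) hadj hadj') hz hz'
      · exact Set.disjoint_left.1 (disjoint_segment_of_pages hx hr ho hcross hcd hab h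
          hac had hadj' hadj) hz' hz
    intro a b c d hab hcd hne
    have hright : ∀ a b, a < b → H.Adj a b → s(a, b) ≠ s(c, d) →
        segment ℝ (P a) (P b) ∩ segment ℝ (P c) (P d) ⊆ P '' (({a, b} : Set V) ∩ {c, d}) := by
      intro a b hlt hab hne
      rcases hcd.ne.lt_or_gt with h | h
      · exact hsorted a b c d hlt h hab hcd hne
      · rw [segment_symm ℝ (P c), Set.pair_comm c]
        exact hsorted a b d c hlt h hab hcd.symm (by rwa [Sym2.eq_swap (a := d)])
    rcases hab.ne.lt_or_gt with h | h
    · exact hright a b h hab hne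
    · rw [segment_symm ℝ (P a), Set.pair_comm a]
      exact hright b a h hab.symm (by rwa [Sym2.eq_swap (a := b)])

end Drawing

theorem IsCrossingFreeDrawing.mono {V : Type u} {G G' : SimpleGraph V} {f : V → ℝ × ℝ}
    (h : IsCrossingFreeDrawing G f) (hle : G' ≤ G) : IsCrossingFreeDrawing G' f where
  injective := h.injective
  vertex_notMem a b w hab := h.vertex_notMem a b w (hle hab)
  edge_inter a b c d hab hcd := h.edge_inter a b c d (hle hab) (hle hcd)

/-! ### Drawings on the double chain -/

section DoubleChain

variable {y : ℕ → ℝ}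

theorem doubleChain_succ (y : ℕ → ℝ) (n : ℕ) :
    doubleChain y (n + 1) = insert (upperPt y (n + 1)) (insert (lowerPt y (n + 1))
      (doubleChain y n)) := by
  ext x
  simp only [doubleChain, Set.mem_insert_iff, Set.mem_ofPred_eq]
  constructor
  · rintro ⟨i, h1, h2, h⟩
    rcases Nat.le_succ_iff.1 h2 with h2 | rfl
    · exact Or.inr (Or.inr ⟨i, h1, h2, h⟩)
    · rcases h with h | h
      · exact Or.inl h
      · exact Or.inr (Or.inl h)
  · rintro (h | h | ⟨i, h1, h2, h⟩)
    · exact ⟨n + 1, by omega, le_rfl, Or.inl h⟩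
    · exact ⟨n + 1, by omega, le_rfl, Or.inr h⟩
    · exact ⟨i, h1, by omega, h⟩

theorem fst_le_of_mem_doubleChain {n : ℕ} {x : ℝ × ℝ} (hx : x ∈ doubleChain y n) : x.1 ≤ n := by
  obtain ⟨i, -, h, rfl | rfl⟩ := hx <;> simpa [upperPt, lowerPt] using h

theorem upperPt_mem_doubleChain {i n : ℕ} (h1 : 1 ≤ i) (h : i ≤ n) :
    upperPt y i ∈ doubleChain y n :=
  ⟨i, h1, h, Or.inl rfl⟩

/-- The defining property of an exploding sequence, for the intersection point of the line through
`a` and `b` with a vertical line written out by similar triangles. -/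
theorem IsExploding.abs_lt (hy : IsExploding y) {n : ℕ} {a b : ℝ × ℝ} (ha : a ∈ doubleChain y n)
    (hb : b ∈ doubleChain y n) (hab : a.1 < b.1) :
    |a.2 + (n + 1 - a.1) / (b.1 - a.1) * (b.2 - a.2)| < y (n + 1) := by
  have hne : b.1 - a.1 ≠ 0 := (sub_pos.2 hab).ne'
  have h := hy.2.2 n a ha b hb (fun h => hab.ne (congrArg Prod.fst h))
    (AffineMap.lineMap a b ((n + 1 - a.1) / (b.1 - a.1)))
    (AffineMap.lineMap_mem_affineSpan_pair _ _ _)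
    (by simp [AffineMap.lineMap_apply]; field_simp; ring)
  rw [_root_.abs_lt]
  simpa [AffineMap.lineMap_apply, add_comm] using h

theorem IsExploding.pos (hy : IsExploding y) {n : ℕ} (hn : 2 ≤ n) : 0 < y (n + 1) := by
  refine (abs_nonneg _).trans_lt (hy.abs_lt (n := n)
    (upperPt_mem_doubleChain (i := 1) le_rfl (by omega))
    (upperPt_mem_doubleChain (i := 2) (by omega) hn) ?_)
  simp [upperPt]

theorem IsExploding.ncard_doubleChain (hy : IsExploding y) {n : ℕ} (hn : 2 ≤ n) :
    (doubleChain y n).Finite ∧ (doubleChain y n).ncard = 2 * n - 2 := by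
  induction n, hn using Nat.le_induction with
  | base =>
    have h : doubleChain y 2 = {((1 : ℝ), (0 : ℝ)), ((2 : ℝ), (0 : ℝ))} := by
      have h0 : doubleChain y 0 = ∅ :=
        Set.eq_empty_of_forall_notMem fun x ⟨i, h1, h2, _⟩ => by omega
      rw [doubleChain_succ, doubleChain_succ, h0]
      ext x
      simp [upperPt, lowerPt, hy.1, hy.2.1, or_comm]
    rw [h, Set.ncard_pair (by simp)]
    exact ⟨Set.toFinite _, rfl⟩
  | succ n hn ih =>
    have hlow : lowerPt y (n + 1) ∉ doubleChain y n := fun h => by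
      have := fst_le_of_mem_doubleChain h
      simp only [lowerPt, Nat.cast_add, Nat.cast_one] at this
      linarith
    have hup : upperPt y (n + 1) ∉ insert (lowerPt y (n + 1)) (doubleChain y n) := by
      rintro (h | h)
      · have h2 : y (n + 1) = -y (n + 1) := congrArg Prod.snd h
        have := hy.pos hn
        linarith
      · have := fst_le_of_mem_doubleChain h
        simp only [upperPt, Nat.cast_add, Nat.cast_one] at this
        linarith
    rw [doubleChain_succ, Set.ncard_insert_of_notMem hup (ih.1.insert _),
      Set.ncard_insert_of_notMem hlow ih.1, ih.2]
    exact ⟨(ih.1.insert _).insert _, by omega⟩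

/-- The point of the double chain with abscissa `i` on the upper chain (`r = 1`) or on the lower
chain (`r = -1`). -/
def chainPt (y : ℕ → ℝ) (r : ℝ) (i : ℕ) : ℝ × ℝ := ((i : ℝ), r * y i)

theorem chainPt_eq {r : ℝ} (hr : r = 1 ∨ r = -1) (i : ℕ) :
    chainPt y r i = upperPt y i ∨ chainPt y r i = lowerPt y i := by
  rcases hr with rfl | rfl <;> simp [chainPt, upperPt, lowerPt]

theorem IsExploding.orient_pos (hy : IsExploding y) {i k l : ℕ} {r s t : ℝ}
    (hr : r = 1 ∨ r = -1) (hs : s = 1 ∨ s = -1) (ht : t = 1 ∨ t = -1) (hi : 1 ≤ i) (hik : i < k)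
    (hkl : k < l) : 0 < t * orient (chainPt y r i) (chainPt y s k) (chainPt y t l) := by
  obtain ⟨n, rfl⟩ : ∃ n, l = n + 1 := ⟨l - 1, by omega⟩
  have hik' : (i : ℝ) < k := by exact_mod_cast hik
  have h := hy.abs_lt (n := n) (a := chainPt y r i) (b := chainPt y s k)
    ⟨i, hi, by omega, chainPt_eq hr i⟩ ⟨k, by omega, by omega, chainPt_eq hs k⟩ hik'
  rw [_root_.abs_lt] at h
  have hpos : 0 < (k : ℝ) - i := sub_pos.2 hik'
  set z := (chainPt y r i).2 + ((n : ℝ) + 1 - (chainPt y r i).1) /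
    ((chainPt y s k).1 - (chainPt y r i).1) * ((chainPt y s k).2 - (chainPt y r i).2) with hz
  have key : orient (chainPt y r i) (chainPt y s k) (chainPt y t (n + 1)) =
      ((k : ℝ) - i) * (t * y (n + 1) - z) := by
    rw [hz]
    simp only [orient, chainPt, Nat.cast_add, Nat.cast_one]
    field_simp
    ring
  rw [key]
  rcases ht with rfl | rfl
  · have := mul_pos hpos (sub_pos.2 h.2)
    linarith
  · have := mul_pos hpos (neg_lt_iff_pos_add.1 h.1)
    linarith

theorem IsOneSidedHamiltonianCycle.exists_drawing (hy : IsExploding y) {V : Type u} [Finite V]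
    {G : SimpleGraph V} {M : PlaneEmbedding G} {n : ℕ} {v : Fin n ≃ V}
    (h : IsOneSidedHamiltonianCycle M v) :
    ∃ f : V → ℝ × ℝ, IsCrossingFreeDrawing G f ∧
      ∀ i : Fin n, f (v i) = upperPt y ((i : ℕ) + 1) ∨ f (v i) = lowerPt y ((i : ℕ) + 1) := by
  obtain ⟨s, hs⟩ := h.exists_pages
  let _ : LinearOrder V := LinearOrder.lift' v.symm v.symm.injective
  have hlt : ∀ a b : V, a < b ↔ (v.symm a : ℕ) < v.symm b := fun _ _ => Iff.rfl
  let r : V → ℝ := fun a => if s (v.symm a) = 0 then 1 else -1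
  have hr : ∀ a, r a = 1 ∨ r a = -1 := fun a => ite_eq_or_eq _ _ _
  refine ⟨fun a => chainPt y (r a) ((v.symm a : ℕ) + 1),
    isCrossingFreeDrawing_of_pages (r := r) ?_ hr ?_ ?_, fun i => ?_⟩
  · intro a b hab
    have := (hlt a b).1 hab
    simpa [chainPt] using this
  · intro a b c hab hbc
    rw [hlt] at hab hbc
    exact hy.orient_pos (hr a) (hr b) (hr c) (by omega) (by omega) (by omega)
  · intro i k j l hik hkj hjl hij hkl hrr
    refine hs (v.symm i) (v.symm k) (v.symm j) (v.symm l) hik hkj hjl (by simpa using hij)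
      (by simpa using hkl) ?_
    -- an element of `ZMod 2` is determined by whether it vanishes
    have hiff : s (v.symm j) = 0 ↔ s (v.symm l) = 0 := by
      by_cases h1 : s (v.symm j) = 0 <;> by_cases h2 : s (v.symm l) = 0 <;>
        simp only [r, h1, h2, if_true, if_false] at hrr ⊢ <;> norm_num at hrr
    exact (by decide : ∀ p q : ZMod 2, (p = 0 ↔ q = 0) → p = q) _ _ hiff
  · simpa using chainPt_eq (y := y) (hr (v i)) ((i : ℕ) + 1)

end DoubleChain

theorem theorem1 (y : ℕ → ℝ) (hy : IsExploding y) :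
    (∀ n : ℕ, 2 ≤ n → (doubleChain y n).ncard = 2 * n - 2) ∧
    (∀ (V : Type u) [Finite V] (G' G : SimpleGraph V) (M : PlaneEmbedding G)
      (n : ℕ) (v : Fin n ≃ V), G' ≤ G → IsOneSidedHamiltonianCycle M v →
      ∃ f : V → ℝ × ℝ, IsCrossingFreeDrawing G' f ∧
        ∀ i : Fin n, f (v i) = upperPt y ((i : ℕ) + 1) ∨ f (v i) = lowerPt y ((i : ℕ) + 1)) ∧
    (∀ n : ℕ, 2 ≤ n → IsUniversalPointSet.{u} n (doubleChain y n) IsPOSH) := by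
  refine ⟨fun n hn => (hy.ncard_doubleChain hn).2, fun V _ G' G M n v hle h => ?_, ?_⟩
  · obtain ⟨f, hf, hfv⟩ := h.exists_drawing hy
    exact ⟨f, hf.mono hle, hfv⟩
  · rintro n - V _ G' hcard ⟨G, M, m, v, hle, h⟩
    obtain rfl : m = n := by rw [← hcard, ← Nat.card_congr v, Nat.card_fin]
    obtain ⟨f, hf, hfv⟩ := h.exists_drawing hy
    refine ⟨f, hf.mono hle, fun a => ?_⟩
    obtain ⟨i, rfl⟩ := v.surjective a
    exact ⟨(i : ℕ) + 1, by omega, i.isLt, hfv i⟩
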